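/- For a finite set $X$, call $\mathcal F\subseteq 2^X$ increasing if $B\supseteq A\in\mathcal F$ implies $B\in\mathcal F$. For $p\in[0,1]$ put $\mu_p(\mathcal F)=\sum_{S\in\mathcal F}p^{|S|}(1-p)^{|X\setminus S|}$. For an increasing $\mathcal F\neq\emptyset,2^X$, the threshold $p_c(\mathcal F)$ is the unique $p\in[0,1]$ with $\mu_p(\mathcal F)=1/2$; the fractional expectation-threshold $q_f(\mathcal F)$ is the largest $p\in[0,1]$ for which there is a function $g:2^X\to[0,\infty)$ with $\sum_{S\subseteq T}g(S)\ge 1$ for all $T\in\mathcal F$ and $\sum_{S\subseteq X}g(S)p^{|S|}\le 1/2$; and $\ell(\mathcal F)$ is the largest size of an (inclusion-)minimal element of $\mathcal F$. **Theorem.** There is a universal constant $K$ such that for every finite set $X$ and every increasing family $\mathcal F\subseteq 2^X$ with $\mathcal F\ne\emptyset,2^X$ and $\ell(\mathcal F)\ge 2$, $$p_c(\mathcal F)\le K\,q_f(\mathcal F)\log \ell(\mathcal F).$$ -/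

import Mathlib

noncomputable section

namespace FracThreshold

variable {X : Type*} [Fintype X] [DecidableEq X]

/-- The mass `μ_p(F) = ∑_{S ∈ F} p^|S| (1 - p)^|X \ S|` of a family `F ⊆ 2^X` under the
`p`-biased product measure. -/
def mu (p : ℝ) (F : Finset (Finset X)) : ℝ :=
  ∑ S ∈ F, p ^ S.card * (1 - p) ^ Sᶜ.card

/-- The threshold `p_c(F)`: the `p ∈ [0,1]` with `μ_p(F) = 1/2`. For increasing `F ≠ ∅, 2^X` the set
below has exactly one element (`existsUnique_threshold`, `threshold_spec`). -/
def threshold (F : Finset (Finset X)) : ℝ :=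
  sInf {p : ℝ | p ∈ Set.Icc (0 : ℝ) 1 ∧ mu p F = 1 / 2}

/-- `F` is weakly `p`-small. -/
def WeaklySmall (p : ℝ) (F : Finset (Finset X)) : Prop :=
  ∃ g : Finset X → ℝ, (∀ S, 0 ≤ g S) ∧ (∀ T ∈ F, 1 ≤ ∑ S ∈ T.powerset, g S) ∧
    ∑ S : Finset X, g S * p ^ S.card ≤ 1 / 2

/-- The fractional expectation-threshold `q_f(F)`: the largest `p ∈ [0,1]` such that `F` is weakly
`p`-small. For increasing `F ≠ 2^X` the maximum is attained (`isGreatest_fracExpThreshold`). -/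
def fracExpThreshold (F : Finset (Finset X)) : ℝ :=
  sSup {p : ℝ | p ∈ Set.Icc (0 : ℝ) 1 ∧ WeaklySmall p F}

open Classical in
/-- `ℓ(F)`: the largest size of a minimal element of `F`. -/
def maxMinSize (F : Finset (Finset X)) : ℕ :=
  (F.filter fun S => Minimal (· ∈ F) S).sup Finset.card

/-! The threshold and the fractional expectation-threshold are well defined. -/

theorem empty_notMem {X : Type*} [Fintype X] {F : Finset (Finset X)} (hF : IsUpperSet (F : Set (Finset X)))
    (h1 : F ≠ Finset.univ) : ∅ ∉ F := by
  intro h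
  exact h1 (Finset.eq_univ_iff_forall.2 fun S => hF (Finset.empty_subset S) h)

theorem univ_mem {X : Type*} [Fintype X] {F : Finset (Finset X)} (hF : IsUpperSet (F : Set (Finset X)))
    (h0 : F.Nonempty) : Finset.univ ∈ F := by
  obtain ⟨S, hS⟩ := h0
  exact hF (Finset.subset_univ S) hS

theorem mu_thin (r s : ℝ) (F : Finset (Finset X)) :
    mu (r * s) F = ∑ A : Finset X, r ^ A.card * (1 - r) ^ Aᶜ.card *
      ∑ B ∈ A.powerset, if B ∈ F then s ^ B.card * (1 - s) ^ (A.card - B.card) else 0 := by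
  have key : ∀ B : Finset X, (r * s) ^ B.card * (1 - r * s) ^ Bᶜ.card =
      ∑ A : Finset X, if B ⊆ A then r ^ A.card * (1 - r) ^ Aᶜ.card *
        (s ^ B.card * (1 - s) ^ (A.card - B.card)) else 0 := by
    intro B
    have h1 : (1 - r * s) = r * (1 - s) + (1 - r) := by ring
    rw [h1, ← Finset.sum_pow_mul_eq_add_pow, Finset.mul_sum, ← Finset.sum_filter]
    refine Finset.sum_bij' (fun C _ => B ∪ C) (fun A _ => A \ B) ?_ ?_ ?_ ?_ ?_
    · intro C _
      simp
    · intro A _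
      simp only [Finset.mem_powerset]
      intro x hx
      simp at hx ⊢
      exact hx.2
    · intro C hC
      have hd : Disjoint C B := by
        rw [Finset.mem_powerset] at hC
        exact (Finset.subset_compl_iff_disjoint_right.1 hC)
      rw [Finset.union_sdiff_left]
      exact sdiff_eq_left.2 hd
    · intro A hA
      exact Finset.union_sdiff_of_subset (Finset.mem_filter.1 hA).2
    · intro C hC
      have hd : Disjoint B C := by
        rw [Finset.mem_powerset] at hC
        exact (Finset.subset_compl_iff_disjoint_right.1 hC).symm
      have hc : (B ∪ C).card = B.card + C.card := Finset.card_union_of_disjoint hd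
      have hcc : (B ∪ C)ᶜ.card = Bᶜ.card - C.card := by
        rw [Finset.card_compl, Finset.card_compl, hc]; omega
      rw [hcc, hc, Nat.add_sub_cancel_left, mul_pow, mul_pow, pow_add]
      ring
  unfold mu
  simp_rw [key, Finset.mul_sum, ← Finset.filter_subset_univ]
  simp_rw [Finset.sum_filter]
  rw [Finset.sum_comm]
  refine Finset.sum_congr rfl fun A _ => ?_
  rw [← Finset.sum_subset (Finset.subset_univ F)]
  · refine Finset.sum_congr rfl fun B hB => ?_
    simp [hB]
  · intro B _ hB
    simp [hB]

theorem mu_strictMono {F : Finset (Finset X)} (hF : IsUpperSet (F : Set (Finset X)))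
    (h0 : F.Nonempty) (h1 : F ≠ Finset.univ) :
    StrictMonoOn (fun p : ℝ => mu p F) (Set.Icc 0 1) := by
  intro p hp r hr hpr
  have hr0 : 0 < r := lt_of_le_of_lt hp.1 hpr
  obtain ⟨s, hs0, hs1, rfl⟩ : ∃ s : ℝ, 0 ≤ s ∧ s < 1 ∧ r * s = p :=
    ⟨p / r, div_nonneg hp.1 hr0.le, (div_lt_one hr0).2 hpr, by field_simp⟩
  have hs1' : 0 < 1 - s := by linarith
  have tot : ∀ A : Finset X, ∑ B ∈ A.powerset, s ^ B.card * (1 - s) ^ (A.card - B.card) = 1 := by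
    intro A
    rw [Finset.sum_pow_mul_eq_add_pow]; simp
  have nn : ∀ A B : Finset X, 0 ≤ s ^ B.card * (1 - s) ^ (A.card - B.card) := by
    intro A B; positivity
  have wn : ∀ A : Finset X, 0 ≤ r ^ A.card * (1 - r) ^ Aᶜ.card := by
    intro A
    have : 0 ≤ 1 - r := by linarith [hr.2]
    positivity
  have hmu : mu r F = ∑ A : Finset X, r ^ A.card * (1 - r) ^ Aᶜ.card * (if A ∈ F then 1 else 0) := by
    simp [mu]
  show mu (r * s) F < mu r F
  rw [mu_thin, hmu]
  refine Finset.sum_lt_sum (fun A _ => mul_le_mul_of_nonneg_left ?_ (wn A))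
    ⟨Finset.univ, Finset.mem_univ _, ?_⟩
  · split_ifs with hA
    · refine le_trans (Finset.sum_le_sum fun B _ => ?_) (tot A).le
      split_ifs
      · exact le_rfl
      · exact nn A B
    · refine le_of_eq (Finset.sum_eq_zero fun B hB => ?_)
      rw [if_neg]
      intro hB'
      exact hA (hF (Finset.mem_powerset.1 hB) hB')
  · refine mul_lt_mul_of_pos_left ?_ ?_
    · rw [if_pos (univ_mem hF h0)]
      refine lt_of_lt_of_le (Finset.sum_lt_sum (fun B _ => ?_) ⟨∅, by simp, ?_⟩)
        (tot Finset.univ).le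
      · split_ifs
        · exact le_rfl
        · exact nn _ B
      · rw [if_neg (empty_notMem hF h1)]
        simp only [Finset.card_empty, pow_zero, one_mul]
        positivity
    · simp only [Finset.compl_univ, Finset.card_empty, pow_zero, mul_one]
      positivity

theorem existsUnique_threshold {F : Finset (Finset X)} (hF : IsUpperSet (F : Set (Finset X)))
    (h0 : F.Nonempty) (h1 : F ≠ Finset.univ) :
    ∃! p : ℝ, p ∈ Set.Icc (0 : ℝ) 1 ∧ mu p F = 1 / 2 := by
  have hc : ContinuousOn (fun p : ℝ => mu p F) (Set.Icc 0 1) := by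
    unfold mu; fun_prop
  have e0 : mu 0 F = 0 := by
    refine Finset.sum_eq_zero fun S hS => ?_
    have : S ≠ ∅ := fun h => empty_notMem hF h1 (h ▸ hS)
    simp [this]
  have e1 : mu 1 F = 1 := by
    unfold mu
    rw [Finset.sum_eq_single_of_mem _ (univ_mem hF h0)]
    · simp
    · intro S _ hS
      simp only [sub_self, one_pow, one_mul]
      refine zero_pow ?_
      simpa using hS
  have hm : (1 / 2 : ℝ) ∈ Set.Icc (mu 0 F) (mu 1 F) := by
    rw [e0, e1]; constructor <;> norm_num
  obtain ⟨p, hp, hp'⟩ := intermediate_value_Icc (by norm_num : (0 : ℝ) ≤ 1) hc hm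
  refine ⟨p, ⟨hp, hp'⟩, ?_⟩
  rintro r ⟨hr, hr'⟩
  exact (mu_strictMono hF h0 h1).injOn hr hp (hr'.trans hp'.symm)

theorem threshold_spec {F : Finset (Finset X)} (hF : IsUpperSet (F : Set (Finset X)))
    (h0 : F.Nonempty) (h1 : F ≠ Finset.univ) :
    threshold F ∈ Set.Icc (0 : ℝ) 1 ∧ mu (threshold F) F = 1 / 2 := by
  obtain ⟨p, hp, hu⟩ := existsUnique_threshold hF h0 h1
  have : {p : ℝ | p ∈ Set.Icc (0 : ℝ) 1 ∧ mu p F = 1 / 2} = {p} :=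
    Set.eq_singleton_iff_unique_mem.2 ⟨hp, hu⟩
  have h : threshold F = p := by rw [threshold, this, csInf_singleton]
  rw [h]; exact hp

theorem isGreatest_fracExpThreshold {F : Finset (Finset X)}
    (hF : IsUpperSet (F : Set (Finset X))) (h1 : F ≠ Finset.univ) :
    IsGreatest {p : ℝ | p ∈ Set.Icc (0 : ℝ) 1 ∧ WeaklySmall p F} (fracExpThreshold F) := by
  have hK : IsCompact ((Set.Icc (0 : ℝ) 1 ×ˢ Set.Icc (0 : Finset X → ℝ) 1) ∩
      {z : ℝ × (Finset X → ℝ) | (∀ T ∈ F, 1 ≤ ∑ S ∈ T.powerset, z.2 S) ∧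
        ∑ S : Finset X, z.2 S * z.1 ^ S.card ≤ 1 / 2}) := by
    refine (isCompact_Icc.prod isCompact_Icc).inter_right ?_
    rw [Set.ofPred_and]
    refine IsClosed.inter ?_ (isClosed_le (by fun_prop) (by fun_prop))
    simp only [Set.ofPred_forall]
    exact isClosed_iInter fun T => isClosed_iInter fun _ =>
      isClosed_le (by fun_prop) (by fun_prop)
  have himg := hK.image continuous_fst
  have heq : {p : ℝ | p ∈ Set.Icc (0 : ℝ) 1 ∧ WeaklySmall p F} = Prod.fst ''
      ((Set.Icc (0 : ℝ) 1 ×ˢ Set.Icc (0 : Finset X → ℝ) 1) ∩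
      {z : ℝ × (Finset X → ℝ) | (∀ T ∈ F, 1 ≤ ∑ S ∈ T.powerset, z.2 S) ∧
        ∑ S : Finset X, z.2 S * z.1 ^ S.card ≤ 1 / 2}) := by
    ext p
    constructor
    · rintro ⟨hp, g, hg0, hg1, hg2⟩
      refine ⟨(p, fun S => min (g S) 1), ⟨⟨hp, fun S => le_min (hg0 S) zero_le_one,
        fun S => min_le_right _ _⟩, fun T hT => ?_, le_trans ?_ hg2⟩, rfl⟩
      · by_cases h : ∃ S ∈ T.powerset, 1 ≤ g S
        · obtain ⟨S, hS, hS1⟩ := h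
          have := Finset.single_le_sum (f := fun S => min (g S) 1)
            (fun S _ => le_min (hg0 S) zero_le_one) hS
          simpa [hS1] using this
        · push Not at h
          refine (hg1 T hT).trans (le_of_eq (Finset.sum_congr rfl fun S hS => ?_))
          exact (min_eq_left (h S hS).le).symm
      · exact Finset.sum_le_sum fun S _ =>
          mul_le_mul_of_nonneg_right (min_le_left _ _) (pow_nonneg hp.1 _)
    · rintro ⟨⟨p', g⟩, ⟨⟨hp, hg, _⟩, hg1, hg2⟩, rfl⟩
      exact ⟨hp, g, fun S => hg S, hg1, hg2⟩
  have hne : {p : ℝ | p ∈ Set.Icc (0 : ℝ) 1 ∧ WeaklySmall p F}.Nonempty := by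
    refine ⟨0, by simp, fun S => if S = ∅ then 0 else 1, fun S => ?_, fun T hT => ?_, ?_⟩
    · dsimp only; split_ifs <;> norm_num
    · have hT' : T ≠ ∅ := fun h => empty_notMem hF h1 (h ▸ hT)
      have := Finset.single_le_sum (f := fun S : Finset X => if S = ∅ then (0 : ℝ) else 1)
        (fun S _ => by split_ifs <;> norm_num) (Finset.mem_powerset_self T)
      simpa [hT'] using this
    · rw [Finset.sum_eq_zero]
      · norm_num
      · intro S _
        by_cases h : S = ∅ <;> simp [h]
  rw [fracExpThreshold]
  rw [heq] at hne ⊢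
  exact himg.isGreatest_sSup hne

end FracThreshold

end

noncomputable section

set_option linter.unusedSectionVars false

namespace FracThreshold

variable {X : Type*} [Fintype X] [DecidableEq X]

/-! Integral covers suffice: the indicator of a cover is an admissible `g`, so for `p > q_f` every
family covering `F` costs more than `1/2`. Take a union of `m` independent `32p`-biased sets, with
`2 ^ m > ℓ(F)`. After exposing one such set `W`, only a fragment `S \ W` remains to be found. The
minimal fragments of at least half the size bound have tiny expected cost
(`sum_weight_mul_cost_fragments_le`); the smaller ones form a new family with a halved size bound.

The induction in `missProb_mul_coverCost_le` keeps the product of miss probability and cover cost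
below `1/4`. Cost above `1/2` thus forces a hit with probability at least `1/2`, whence `p_c ≤
32pm`. Letting `p` decrease to `q_f` gives the theorem. -/

/-! ### Biased random sets and their unions -/

/-- The weight of a single set under the `q`-biased product measure. -/
def weight (q : ℝ) (W : Finset X) : ℝ :=
  q ^ W.card * (1 - q) ^ Wᶜ.card

theorem weight_nonneg {q : ℝ} (h0 : 0 ≤ q) (h1 : q ≤ 1) (W : Finset X) : 0 ≤ weight q W := by
  have : 0 ≤ 1 - q := by linarith
  unfold weight
  positivity

theorem sum_weight (q : ℝ) : ∑ W : Finset X, weight q W = 1 := by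
  have h := Finset.sum_pow_mul_eq_add_pow q (1 - q) (Finset.univ : Finset X)
  simp only [Finset.powerset_univ, add_sub_cancel, one_pow] at h
  rw [← h]
  exact Finset.sum_congr rfl fun W _ => by rw [weight, Finset.card_compl, Finset.card_univ]

/-- For fixed `W`, the law of `W ∪ V` when `V` is an `r`-biased random set. -/
theorem sum_weight_union_eq (r : ℝ) {W Z : Finset X} (h : W ⊆ Z) :
    ∑ V : Finset X with W ∪ V = Z, weight r V =
      r ^ (Z.card - W.card) * (1 - r) ^ Zᶜ.card := by
  have h1 : ∑ V : Finset X with W ∪ V = Z, weight r V =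
      ∑ V ∈ W.powerset, r ^ (Z.card - W.card) * (1 - r) ^ Zᶜ.card *
        (r ^ V.card * (1 - r) ^ (W.card - V.card)) := by
    -- `V \ W` is forced to be `Z \ W`, while `V ∩ W` is arbitrary.
    refine Finset.sum_bij' (fun V _ => V ∩ W) (fun V _ => V ∪ (Z \ W)) ?_ ?_ ?_ ?_ ?_
    · intro V _
      simp
    · intro V hV
      rw [Finset.mem_powerset] at hV
      simp only [Finset.mem_filter, Finset.mem_univ, true_and]
      ext x
      have := @hV x
      have := @h x
      simp only [Finset.mem_union, Finset.mem_sdiff]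
      tauto
    · intro V hV
      obtain ⟨-, rfl⟩ := Finset.mem_filter.1 hV
      ext x
      simp only [Finset.mem_union, Finset.mem_sdiff, Finset.mem_inter]
      tauto
    · intro V hV
      rw [Finset.mem_powerset] at hV
      ext x
      have := @hV x
      simp only [Finset.mem_union, Finset.mem_sdiff, Finset.mem_inter]
      tauto
    · intro V hV
      obtain ⟨-, rfl⟩ := Finset.mem_filter.1 hV
      have e1 : (W ∪ V).card - W.card = (V \ W).card := by
        rw [← Finset.union_sdiff_left, Finset.card_sdiff_of_subset Finset.subset_union_left]
      have e2 : V.card = (V \ W).card + (V ∩ W).card := (Finset.card_sdiff_add_card_inter V W).symm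
      have e3 : Vᶜ.card = (W ∪ V)ᶜ.card + (W.card - (V ∩ W).card) := by
        have a1 := Finset.card_compl_add_card V
        have a2 := Finset.card_compl_add_card (W ∪ V)
        have a3 := Finset.card_le_card (Finset.subset_union_left : W ⊆ W ∪ V)
        have a4 := Finset.card_le_card (Finset.inter_subset_right : V ∩ W ⊆ W)
        omega
      rw [weight, e3, e1, e2, pow_add, pow_add]
      ring
  rw [h1, ← Finset.mul_sum, Finset.sum_pow_mul_eq_add_pow]
  simp

/-- The union of independent `q`- and `r`-biased random sets is `1 - (1 - q)(1 - r)`-biased. -/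
theorem sum_weight_mul_sum_weight_union (q r : ℝ) (f : Finset X → ℝ) :
    ∑ W : Finset X, weight q W * ∑ V : Finset X, weight r V * f (W ∪ V) =
      ∑ Z : Finset X, weight (1 - (1 - q) * (1 - r)) Z * f Z := by
  have h1 : ∀ W : Finset X, ∑ V : Finset X, weight r V * f (W ∪ V) =
      ∑ Z : Finset X, if W ⊆ Z then r ^ (Z.card - W.card) * (1 - r) ^ Zᶜ.card * f Z else 0 := by
    intro W
    rw [← Finset.sum_fiberwise Finset.univ (fun V => W ∪ V)]
    refine Finset.sum_congr rfl fun Z _ => ?_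
    split_ifs with h
    · rw [← sum_weight_union_eq r h, Finset.sum_mul]
      refine Finset.sum_congr rfl fun V hV => ?_
      rw [(Finset.mem_filter.1 hV).2]
    · refine Finset.sum_eq_zero fun V hV => ?_
      exact absurd ((Finset.mem_filter.1 hV).2 ▸ Finset.subset_union_left) h
  simp_rw [h1, Finset.mul_sum]
  rw [Finset.sum_comm]
  refine Finset.sum_congr rfl fun Z _ => ?_
  have h2 : weight (1 - (1 - q) * (1 - r)) Z = ((1 - q) * (1 - r)) ^ Zᶜ.card *
      ∑ W ∈ Z.powerset, q ^ W.card * ((1 - q) * r) ^ (Z.card - W.card) := by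
    rw [Finset.sum_pow_mul_eq_add_pow, weight]
    ring_nf
  rw [h2, Finset.mul_sum, Finset.sum_mul, ← Finset.filter_subset_univ, Finset.sum_filter]
  refine Finset.sum_congr rfl fun W _ => ?_
  split_ifs with h
  · have e : Wᶜ.card = Zᶜ.card + (Z.card - W.card) := by
      have a1 := Finset.card_compl_add_card W
      have a2 := Finset.card_compl_add_card Z
      have a3 := Finset.card_le_card h
      omega
    rw [weight, e, pow_add, mul_pow, mul_pow]
    ring
  · simp

/-! ### Covers and minimal fragments -/

/-- `G` covers `H` if every member of `H` contains a member of `G`. -/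
def Covers (G H : Finset (Finset X)) : Prop :=
  ∀ S ∈ H, ∃ T ∈ G, T ⊆ S

/-- The total `p`-weight of a family. -/
def cost (p : ℝ) (G : Finset (Finset X)) : ℝ :=
  ∑ T ∈ G, p ^ T.card

open Classical in
/-- The minimal cost of a family covering `H`. -/
def coverCost (p : ℝ) (H : Finset (Finset X)) : ℝ :=
  (Finset.univ.filter fun G : Finset (Finset X) => Covers G H).inf'
    ⟨H, Finset.mem_filter.2 ⟨Finset.mem_univ _, fun S hS => ⟨S, hS, subset_rfl⟩⟩⟩ (cost p)

theorem coverCost_le {p : ℝ} {G H : Finset (Finset X)} (h : Covers G H) :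
    coverCost p H ≤ cost p G := by
  classical
  have hG : G ∈ Finset.univ.filter fun G : Finset (Finset X) => Covers G H :=
    Finset.mem_filter.2 ⟨Finset.mem_univ G, h⟩
  exact Finset.inf'_le (cost p) hG

theorem exists_cost_eq_coverCost (p : ℝ) (H : Finset (Finset X)) :
    ∃ G, Covers G H ∧ coverCost p H = cost p G := by
  classical
  obtain ⟨G, hG, h⟩ := Finset.exists_mem_eq_inf'
    (s := Finset.univ.filter fun G : Finset (Finset X) => Covers G H)
    ⟨H, Finset.mem_filter.2 ⟨Finset.mem_univ _, fun S hS => ⟨S, hS, subset_rfl⟩⟩⟩ (cost p)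
  exact ⟨G, (Finset.mem_filter.1 hG).2, h⟩

theorem cost_nonneg {p : ℝ} (hp : 0 ≤ p) (G : Finset (Finset X)) : 0 ≤ cost p G :=
  Finset.sum_nonneg fun _ _ => pow_nonneg hp _

open Classical in
/-- The inclusion-minimal members of a family. -/
def minimals (H : Finset (Finset X)) : Finset (Finset X) :=
  H.filter fun S => Minimal (· ∈ H) S

theorem mem_minimals {H : Finset (Finset X)} {S : Finset X} :
    S ∈ minimals H ↔ Minimal (· ∈ H) S := by
  classical
  rw [minimals, Finset.mem_filter]
  exact ⟨fun h => h.2, fun h => ⟨h.1, h⟩⟩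

theorem covers_minimals (H : Finset (Finset X)) : Covers (minimals H) H := by
  intro S hS
  obtain ⟨T, hTS, hT⟩ := H.exists_le_minimal hS
  exact ⟨T, mem_minimals.2 hT, hTS⟩

/-- The minimal fragments of `H` with respect to `W`: the minimal sets of the form `S \ W`. -/
def fragments (H : Finset (Finset X)) (W : Finset X) : Finset (Finset X) :=
  minimals (H.image (· \ W))

theorem exists_sdiff_eq_of_mem_fragments {H : Finset (Finset X)} {W T : Finset X}
    (hT : T ∈ fragments H W) : ∃ S ∈ H, S \ W = T :=
  Finset.mem_image.1 (mem_minimals.1 hT).1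

/-- A member of `H` inside `W ∪ T`, for a minimal fragment `T`, has fragment exactly `T`. -/
theorem sdiff_eq_of_mem_fragments {H : Finset (Finset X)} {W T S : Finset X}
    (hT : T ∈ fragments H W) (hS : S ∈ H) (h : S ⊆ W ∪ T) : S \ W = T := by
  have hsub : S \ W ⊆ T := by
    rw [sdiff_le_iff]
    exact h
  exact hsub.antisymm ((mem_minimals.1 hT).2 (Finset.mem_image_of_mem _ hS) hsub)

/-- Every member of `H` contains a minimal fragment. A large one joins the cover itself; a small one
contains a member of an optimal cover of the small ones. -/
theorem coverCost_le_fragments {p : ℝ} (hp : 0 ≤ p) (H : Finset (Finset X)) (W : Finset X) (k : ℕ) :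
    coverCost p H ≤ cost p {T ∈ fragments H W | k ≤ T.card} +
      coverCost p {T ∈ fragments H W | T.card < k} := by
  obtain ⟨G, hG, e⟩ := exists_cost_eq_coverCost p {T ∈ fragments H W | T.card < k}
  rw [e]
  refine le_trans (coverCost_le (G := {T ∈ fragments H W | k ≤ T.card} ∪ G) ?_) ?_
  · intro S hS
    obtain ⟨T, hT, hTS⟩ := covers_minimals (H.image (· \ W)) (S \ W) (Finset.mem_image_of_mem _ hS)
    have hTS' : T ⊆ S := hTS.trans Finset.sdiff_subset
    rcases lt_or_ge T.card k with hk | hk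
    · obtain ⟨R, hR, hRT⟩ := hG T (Finset.mem_filter.2 ⟨hT, hk⟩)
      exact ⟨R, Finset.mem_union_right _ hR, hRT.trans hTS'⟩
    · exact ⟨T, Finset.mem_union_left _ (Finset.mem_filter.2 ⟨hT, hk⟩), hTS'⟩
  · unfold cost
    rw [← Finset.sum_union_inter]
    exact le_add_of_nonneg_right (cost_nonneg hp _)

/-! ### Expected cost of the large fragments -/

/-- Moving a set `T` disjoint from `W` into a `q`-biased random set. -/
theorem weight_mul_pow_le {p q L : ℝ} (hp : 0 ≤ p) (hL : 0 < L) (hq : q = L * p) (hq1 : q ≤ 1)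
    {W T : Finset X} (h : Disjoint W T) :
    weight q W * p ^ T.card ≤ weight q (W ∪ T) * (L⁻¹) ^ T.card := by
  have hq0 : 0 ≤ q := by rw [hq]; positivity
  have hq1' : 0 ≤ 1 - q := by linarith
  have e1 : (W ∪ T).card = W.card + T.card := Finset.card_union_of_disjoint h
  have e2 : Wᶜ.card = (W ∪ T)ᶜ.card + T.card := by
    have a1 := Finset.card_compl_add_card W
    have a2 := Finset.card_compl_add_card (W ∪ T)
    omega
  have e3 : p = q * L⁻¹ := by rw [hq]; field_simp
  have e4 : weight q W * p ^ T.card =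
      weight q (W ∪ T) * (L⁻¹) ^ T.card * (1 - q) ^ T.card := by
    rw [weight, weight, e1, e2, show p ^ T.card = q ^ T.card * (L⁻¹) ^ T.card by rw [← mul_pow, ← e3],
      pow_add, pow_add]
    ring
  rw [e4]
  refine mul_le_of_le_one_right ?_ (pow_le_one₀ hq1' (by linarith))
  exact mul_nonneg (weight_nonneg hq0 hq1 _) (by positivity)

/-- The expected cost of the large minimal fragments of a family of sets of size at most `2 * k`. -/
theorem sum_weight_mul_cost_fragments_le {p q L : ℝ} (hp : 0 ≤ p) (hL : 1 ≤ L) (hq : q = L * p)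
    (hq1 : q ≤ 1) {H : Finset (Finset X)} {k : ℕ} (hH : ∀ S ∈ H, S.card ≤ 2 * k) :
    ∑ W : Finset X, weight q W * cost p {T ∈ fragments H W | k ≤ T.card} ≤ (4 / L) ^ k := by
  classical
  have hL0 : 0 < L := by linarith
  have hq0 : 0 ≤ q := by rw [hq]; positivity
  -- Encode `(W, T)` as `(Z, T)` with `Z = W ∪ T`. Since `c Z` depends on `Z` alone, `T ⊆ c Z`
  -- leaves at most `2 ^ (2 * k)` choices of `T` for each `Z`.
  choose! c hc using fun (Z : Finset X) (h : ∃ S ∈ H, S ⊆ Z) => h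
  let D : Finset (Σ _ : Finset X, Finset X) :=
    Finset.univ.sigma fun W => {T ∈ fragments H W | k ≤ T.card}
  let E : Finset (Σ _ : Finset X, Finset X) :=
    Finset.univ.sigma fun Z => if ∃ S ∈ H, S ⊆ Z then (c Z).powerset else ∅
  let φ : (Σ _ : Finset X, Finset X) → (Σ _ : Finset X, Finset X) := fun z => ⟨z.1 ∪ z.2, z.2⟩
  have hdisj : ∀ z ∈ D, Disjoint z.1 z.2 := by
    intro z hz
    obtain ⟨S, -, h⟩ := exists_sdiff_eq_of_mem_fragments
      (Finset.mem_filter.1 (Finset.mem_sigma.1 hz).2).1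
    rw [← h]
    exact Finset.disjoint_sdiff
  have hinj : Set.InjOn φ D := by
    rintro ⟨W, T⟩ hz ⟨W', T'⟩ hz' h
    simp only [φ, Sigma.mk.injEq, heq_eq_eq] at h
    obtain ⟨h1, rfl⟩ := h
    have a : Disjoint W T := hdisj _ hz
    have a' : Disjoint W' T := hdisj _ hz'
    have : W = W' := by
      rw [← Finset.union_sdiff_cancel_right a, ← Finset.union_sdiff_cancel_right a', h1]
    rw [this]
  have hmaps : D.image φ ⊆ E := by
    intro z hz
    obtain ⟨⟨W, T⟩, hWT, rfl⟩ := Finset.mem_image.1 hz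
    have hT := (Finset.mem_filter.1 (Finset.mem_sigma.1 hWT).2).1
    obtain ⟨S, hS, h⟩ := exists_sdiff_eq_of_mem_fragments hT
    have hex : ∃ S ∈ H, S ⊆ W ∪ T := ⟨S, hS, sdiff_le_iff.1 h.subset⟩
    refine Finset.mem_sigma.2 ⟨Finset.mem_univ _, ?_⟩
    simp only [φ]
    rw [if_pos hex, Finset.mem_powerset]
    -- `c (W ∪ T)` need not be the `S` that produced `T`, but minimality of `T` makes its fragment
    -- equal to `T`.
    have := sdiff_eq_of_mem_fragments hT (hc _ hex).1 (hc _ hex).2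
    calc T = c (W ∪ T) \ W := this.symm
      _ ⊆ c (W ∪ T) := Finset.sdiff_subset
  have hLk : 0 ≤ (L⁻¹) ^ k := by positivity
  calc ∑ W : Finset X, weight q W * cost p {T ∈ fragments H W | k ≤ T.card}
      = ∑ z ∈ D, weight q z.1 * p ^ z.2.card := by
        simp_rw [cost, Finset.mul_sum]
        rw [Finset.sum_sigma]
    _ ≤ ∑ z ∈ D, weight q (φ z).1 * (L⁻¹) ^ k := by
        refine Finset.sum_le_sum fun z hz => ?_
        refine (weight_mul_pow_le hp hL0 hq hq1 (hdisj z hz)).trans ?_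
        refine mul_le_mul_of_nonneg_left ?_ (weight_nonneg hq0 hq1 _)
        exact pow_le_pow_of_le_one (by positivity) (inv_le_one_of_one_le₀ hL)
          (Finset.mem_filter.1 (Finset.mem_sigma.1 hz).2).2
    _ = ∑ z ∈ D.image φ, weight q z.1 * (L⁻¹) ^ k := by
        rw [Finset.sum_image hinj]
    _ ≤ ∑ z ∈ E, weight q z.1 * (L⁻¹) ^ k :=
        Finset.sum_le_sum_of_subset_of_nonneg hmaps fun z _ _ =>
          mul_nonneg (weight_nonneg hq0 hq1 _) hLk
    _ ≤ ∑ Z : Finset X, weight q Z * (4 / L) ^ k := by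
        rw [Finset.sum_sigma]
        refine Finset.sum_le_sum fun Z _ => ?_
        have h4 : (4 / L) ^ k = 2 ^ (2 * k) * (L⁻¹) ^ k := by
          rw [div_eq_mul_inv, mul_pow, pow_mul]
          norm_num
        simp only [Finset.sum_const]
        rw [nsmul_eq_mul, h4, mul_left_comm]
        refine mul_le_mul_of_nonneg_left (mul_le_mul_of_nonneg_right ?_ hLk)
          (weight_nonneg hq0 hq1 _)
        split_ifs with h
        · rw [Finset.card_powerset]
          push_cast
          exact pow_le_pow_right₀ (by norm_num) (hH _ (hc Z h).1)
        · simp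
    _ = (4 / L) ^ k := by rw [← Finset.sum_mul, sum_weight, one_mul]

/-! ### Miss probability and the iteration -/

open Classical in
/-- The probability that a `q`-biased random set contains no member of `H`. -/
def missProb (q : ℝ) (H : Finset (Finset X)) : ℝ :=
  ∑ W : Finset X, weight q W * if ∃ S ∈ H, S ⊆ W then 0 else 1

/-- If `V` contains a fragment `S \ W`, then `W ∪ V` contains `S`. -/
theorem missProb_le_sum_fragments {q r : ℝ} (hq0 : 0 ≤ q) (hq1 : q ≤ 1) (hr0 : 0 ≤ r) (hr1 : r ≤ 1)
    (H : Finset (Finset X)) (k : ℕ) :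
    missProb (1 - (1 - q) * (1 - r)) H ≤
      ∑ W : Finset X, weight q W * missProb r {T ∈ fragments H W | T.card < k} := by
  classical
  unfold missProb
  rw [← sum_weight_mul_sum_weight_union]
  refine Finset.sum_le_sum fun W _ => mul_le_mul_of_nonneg_left ?_ (weight_nonneg hq0 hq1 _)
  refine Finset.sum_le_sum fun V _ => mul_le_mul_of_nonneg_left ?_ (weight_nonneg hr0 hr1 _)
  split_ifs with h1 h2 h2
  · exact le_rfl
  · exact zero_le_one
  · obtain ⟨T, hT, hTV⟩ := h2
    obtain ⟨S, hS, h⟩ := exists_sdiff_eq_of_mem_fragments (Finset.mem_filter.1 hT).1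
    exact absurd ⟨S, hS, sdiff_le_iff.1 (h.subset.trans hTV)⟩ h1
  · exact le_rfl

theorem missProb_nonneg {q : ℝ} (hq0 : 0 ≤ q) (hq1 : q ≤ 1) (H : Finset (Finset X)) :
    0 ≤ missProb q H := by
  classical
  refine Finset.sum_nonneg fun W _ => mul_nonneg (weight_nonneg hq0 hq1 _) ?_
  split_ifs <;> norm_num

theorem missProb_le_one {q : ℝ} (hq0 : 0 ≤ q) (hq1 : q ≤ 1) (H : Finset (Finset X)) :
    missProb q H ≤ 1 := by
  classical
  rw [← sum_weight (X := X) q]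
  refine Finset.sum_le_sum fun W _ => mul_le_of_le_one_right (weight_nonneg hq0 hq1 _) ?_
  split_ifs <;> norm_num

/-- Working with the product avoids any Markov inequality: for each `W`, the miss probability is
bounded by `1` against the large fragments' cost and retained against the small ones' cover cost,
where `hc` applies. -/
theorem missProb_mul_coverCost_step {p q r L c : ℝ} (hp : 0 ≤ p) (hL : 1 ≤ L) (hq : q = L * p)
    (hq1 : q ≤ 1) (hr0 : 0 ≤ r) (hr1 : r ≤ 1) {H : Finset (Finset X)} {k : ℕ}
    (hH : ∀ S ∈ H, S.card ≤ 2 * k)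
    (hc : ∀ H' : Finset (Finset X), (∀ S ∈ H', S.card < k) →
      missProb r H' * coverCost p H' ≤ c) :
    missProb (1 - (1 - q) * (1 - r)) H * coverCost p H ≤ (4 / L) ^ k + c := by
  have hq0 : 0 ≤ q := by rw [hq]; positivity
  have hcc : 0 ≤ coverCost p H := by
    obtain ⟨G, -, e⟩ := exists_cost_eq_coverCost p H
    rw [e]
    exact cost_nonneg hp G
  calc missProb (1 - (1 - q) * (1 - r)) H * coverCost p H
      ≤ (∑ W : Finset X, weight q W * missProb r {T ∈ fragments H W | T.card < k}) *
          coverCost p H :=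
        mul_le_mul_of_nonneg_right (missProb_le_sum_fragments hq0 hq1 hr0 hr1 H k) hcc
    _ ≤ ∑ W : Finset X, (weight q W * cost p {T ∈ fragments H W | k ≤ T.card} +
          weight q W * c) := by
        rw [Finset.sum_mul]
        refine Finset.sum_le_sum fun W _ => ?_
        rw [mul_assoc, ← mul_add]
        refine mul_le_mul_of_nonneg_left ?_ (weight_nonneg hq0 hq1 _)
        refine (mul_le_mul_of_nonneg_left (coverCost_le_fragments hp H W k)
          (missProb_nonneg hr0 hr1 _)).trans ?_
        rw [mul_add]
        exact add_le_add
          (mul_le_of_le_one_left (cost_nonneg hp _) (missProb_le_one hr0 hr1 _))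
          (hc _ fun S hS => (Finset.mem_filter.1 hS).2)
    _ ≤ (4 / L) ^ k + c := by
        rw [Finset.sum_add_distrib, ← Finset.sum_mul, sum_weight, one_mul]
        exact add_le_add_left (sum_weight_mul_cost_fragments_le hp hL hq hq1 hH) c

/-- A family of sets of size less than `2 ^ m` that is expensive to cover is likely to have a member
inside the union of `m` independent `32 * p`-biased random sets. -/
theorem missProb_mul_coverCost_le {p q : ℝ} (hp : 0 ≤ p) (hq : q = 32 * p) (hq1 : q ≤ 1) (m : ℕ) :
    ∀ H : Finset (Finset X), (∀ S ∈ H, S.card < 2 ^ m) →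
      missProb (1 - (1 - q) ^ m) H * coverCost p H ≤ (1 - (1 / 2) ^ m) / 4 := by
  have hq0 : 0 ≤ q := by rw [hq]; positivity
  induction m with
  | zero =>
    intro H hH
    classical
    simp only [pow_zero, sub_self, zero_div]
    -- Members have size below `2 ^ 0`, so either `H` is empty and costs nothing, or it contains `∅`
    -- and is never missed.
    rcases H.eq_empty_or_nonempty with rfl | ⟨S, hS⟩
    · refine mul_nonpos_of_nonneg_of_nonpos (missProb_nonneg le_rfl zero_le_one _) ?_
      refine (coverCost_le (G := ∅) fun S hS => absurd hS (Finset.notMem_empty S)).trans ?_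
      simp [cost]
    · have hS0 : S = ∅ := by
        have := hH S hS
        rw [← Finset.card_eq_zero]
        omega
      have : missProb 0 H = 0 := by
        refine Finset.sum_eq_zero fun W _ => ?_
        rw [if_pos ⟨S, hS, by rw [hS0]; exact Finset.empty_subset W⟩, mul_zero]
      rw [this, zero_mul]
  | succ m ih =>
    intro H hH
    have h0 : 0 ≤ (1 - q) ^ m := pow_nonneg (by linarith) m
    have h1 : (1 - q) ^ m ≤ 1 := pow_le_one₀ (by linarith) (by linarith)
    have hstep := missProb_mul_coverCost_step (r := 1 - (1 - q) ^ m) hp (by norm_num) hq hq1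
      (by linarith) (by linarith) (k := 2 ^ m)
      (fun S hS => by have := hH S hS; rw [pow_succ] at this; omega) ih
    rw [show 1 - (1 - q) * (1 - (1 - (1 - q) ^ m)) = 1 - (1 - q) ^ (m + 1) by ring] at hstep
    refine hstep.trans ?_
    -- With `L = 32` the errors are dominated by the terms `(1 / 2) ^ m / 8`, whose sum over all `m`
    -- is `1 / 4`.
    have h2 : (4 / 32 : ℝ) ^ (2 ^ m) ≤ (1 / 2) ^ m / 8 := by
      calc (4 / 32 : ℝ) ^ (2 ^ m) ≤ (4 / 32) ^ (m + 1) :=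
            pow_le_pow_of_le_one (by norm_num) (by norm_num) Nat.lt_two_pow_self
        _ = (1 / 8) ^ m / 8 := by rw [pow_succ]; norm_num; ring
        _ ≤ (1 / 2) ^ m / 8 := by gcongr; norm_num
    rw [pow_succ (1 / 2 : ℝ) m]
    linarith

/-! ### From covers to the threshold -/

theorem weaklySmall_of_covers {p : ℝ} {F G : Finset (Finset X)} (h : Covers G F)
    (hG : cost p G ≤ 1 / 2) : WeaklySmall p F := by
  refine ⟨fun S => if S ∈ G then 1 else 0, fun S => by dsimp only; split_ifs <;> norm_num,
    fun T hT => ?_, ?_⟩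
  · obtain ⟨S, hS, hST⟩ := h T hT
    have := Finset.single_le_sum (f := fun S => if S ∈ G then (1 : ℝ) else 0)
      (fun S _ => by split_ifs <;> norm_num) (Finset.mem_powerset.2 hST)
    simpa [hS] using this
  · simpa [cost] using hG

theorem missProb_minimals {F : Finset (Finset X)} (hF : IsUpperSet (F : Set (Finset X))) (q : ℝ) :
    missProb q (minimals F) = 1 - mu q F := by
  classical
  have hmu : mu q F = ∑ W : Finset X, weight q W * if W ∈ F then 1 else 0 := by
    simp [mu, weight]
  rw [← sum_weight (X := X) q, hmu, ← Finset.sum_sub_distrib]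
  refine Finset.sum_congr rfl fun W _ => ?_
  have : (∃ S ∈ minimals F, S ⊆ W) ↔ W ∈ F :=
    ⟨fun ⟨S, hS, hSW⟩ => hF hSW (mem_minimals.1 hS).1, fun h => covers_minimals F W h⟩
  simp only [this]
  split_ifs <;> ring

theorem card_le_maxMinSize {F : Finset (Finset X)} {S : Finset X} (hS : S ∈ minimals F) :
    S.card ≤ maxMinSize F := by
  classical
  unfold maxMinSize
  exact Finset.le_sup (f := Finset.card)
    (Finset.mem_filter.2 ⟨(mem_minimals.1 hS).1, mem_minimals.1 hS⟩)

theorem threshold_le_of_not_weaklySmall {F : Finset (Finset X)}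
    (hF : IsUpperSet (F : Set (Finset X))) (h0 : F.Nonempty) (h1 : F ≠ Finset.univ)
    {p : ℝ} (hp : 0 ≤ p) (hpF : ¬ WeaklySmall p F) {m : ℕ} (hm : maxMinSize F < 2 ^ m)
    (hm0 : m ≠ 0) : threshold F ≤ m * (32 * p) := by
  obtain ⟨ht, hmu⟩ := threshold_spec hF h0 h1
  have hm1 : (1 : ℝ) ≤ m := by exact_mod_cast Nat.one_le_iff_ne_zero.2 hm0
  rcases le_or_gt (32 * p) 1 with hq1 | hq1
  swap
  -- Here the claimed bound exceeds `1`.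
  · nlinarith [ht.2]
  set q := 32 * p with hq
  have hq0 : 0 ≤ q := by positivity
  have hcc : 1 / 2 < coverCost p (minimals F) := by
    by_contra! h
    obtain ⟨G, hG, e⟩ := exists_cost_eq_coverCost p (minimals F)
    refine hpF (weaklySmall_of_covers (G := G) (fun S hS => ?_) (e ▸ h))
    obtain ⟨T, hT, hTS⟩ := covers_minimals F S hS
    obtain ⟨R, hR, hRT⟩ := hG T hT
    exact ⟨R, hR, hRT.trans hTS⟩
  have key := missProb_mul_coverCost_le hp hq hq1 m (minimals F)
    fun S hS => (card_le_maxMinSize hS).trans_lt hm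
  rw [missProb_minimals hF] at key
  have hhalf : (0 : ℝ) ≤ (1 / 2) ^ m := by positivity
  -- Otherwise both factors in `key` exceed `1 / 2`, and their product exceeds `1 / 4`.
  have hle : 1 / 2 ≤ mu (1 - (1 - q) ^ m) F := by
    by_contra! h
    nlinarith
  have hb : 1 - (1 - q) ^ m ∈ Set.Icc (0 : ℝ) 1 :=
    ⟨by linarith [pow_le_one₀ (n := m) (by linarith : 0 ≤ 1 - q) (by linarith)],
      by linarith [pow_nonneg (by linarith : 0 ≤ 1 - q) m]⟩
  have hthr : threshold F ≤ 1 - (1 - q) ^ m :=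
    ((mu_strictMono hF h0 h1).le_iff_le ht hb).1 (hmu.trans_le hle)
  have hbern := one_add_mul_le_pow (a := -q) (by linarith) m
  rw [← sub_eq_add_neg] at hbern
  linarith

/-- The floor of `log₂ l` is at least `1`, so adding one at most doubles it; `log 2 > 1 / 2` gives
the other factor of two. -/
theorem log_two_add_one_le {l : ℕ} (hl : 2 ≤ l) : ((Nat.log 2 l + 1 : ℕ) : ℝ) ≤ 4 * Real.log l := by
  have h2 : (2 : ℝ) ^ Nat.log 2 l ≤ l := by exact_mod_cast Nat.pow_log_le_self 2 (by omega)
  have h3 := Real.log_le_log (by positivity) h2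
  rw [Real.log_pow] at h3
  have h4 : (1 : ℝ) ≤ Nat.log 2 l := by exact_mod_cast Nat.log_pos (by norm_num) hl
  have h5 := Real.log_two_gt_d9
  push_cast
  nlinarith

end FracThreshold

end

theorem theorem1p1 :
    ∃ K : ℝ, ∀ (X : Type*) [Fintype X] [DecidableEq X] (F : Finset (Finset X)),
      IsUpperSet (F : Set (Finset X)) → F.Nonempty → F ≠ Finset.univ →
      2 ≤ FracThreshold.maxMinSize F →
      FracThreshold.threshold F ≤
        K * FracThreshold.fracExpThreshold F * Real.log (FracThreshold.maxMinSize F) := by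
  -- `128 = 32 * 4`: the density factor times the constant in `log_two_add_one_le`.
  refine ⟨128, fun X _ _ F hF h0 h1 hl => ?_⟩
  set l := FracThreshold.maxMinSize F
  obtain ⟨⟨hq, -⟩, hmax⟩ := FracThreshold.isGreatest_fracExpThreshold hF h1
  set qf := FracThreshold.fracExpThreshold F
  have hlog := FracThreshold.log_two_add_one_le hl
  have hlog1 : (1 : ℝ) ≤ 4 * Real.log l := 
    le_trans (by exact_mod_cast Nat.le_add_left 1 _) hlog
  -- If `qf = 1`, no larger `p` is available in `[0, 1]`, but `threshold F ≤ 1` suffices.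
  rcases hq.2.eq_or_lt with h | h
  · rw [h]
    linarith [(FracThreshold.threshold_spec hF h0 h1).1.2]
  · have hlim : Filter.Tendsto (fun p : ℝ => 128 * p * Real.log l) (nhdsWithin qf (Set.Ioi qf))
        (nhds (128 * qf * Real.log l)) :=
      Filter.Tendsto.mono_left (Continuous.tendsto (by fun_prop) qf) nhdsWithin_le_nhds
    refine ge_of_tendsto hlim ?_
    filter_upwards [Ioo_mem_nhdsGT h] with p hp
    have hp0 : 0 ≤ p := hq.1.trans hp.1.le
    have hns : ¬ FracThreshold.WeaklySmall p F := fun hs =>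
      absurd (hmax ⟨⟨hp0, hp.2.le⟩, hs⟩) (not_le.2 hp.1)
    refine (FracThreshold.threshold_le_of_not_weaklySmall hF h0 h1 hp0 hns
      (Nat.lt_pow_succ_log_self (by norm_num) l) (Nat.succ_ne_zero _)).trans ?_
    nlinarith
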